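/- Conventions. A manifold is connected, without boundary and of class $C^4$; a pseudo-Riemannian metric (of arbitrary signature) has coefficients of class $C^3$ in charts. A metric $g$ on an $m$-dimensional manifold is called Einstein if $\mathrm{Ric}=\lambda g$ for some function $\lambda$, where for $m=2$ it is required in addition that $\lambda$ (the Gaussian curvature) is constant. For $m\ge 2$, we say that $g$ is Einstein with normalized Einstein constant $k\in\mathbb R$ if $\mathrm{Ric}=(m-1)k\,g$. Let $(M_*,g_*)$ be a pseudo-Riemannian manifold of dimension $n\ge 2$, let $J\subseteq\mathbb R$ be an open interval, let $\varepsilon\in\{1,-1\}$, and let $f:J\to\mathbb R$ be a non-constant function of class $C^4$ without zeros. Let $\overline g=f(t)^{-2}(\varepsilon\,dt^2+g_*)$, a pseudo-Riemannian metric on $J\times M_*$. Then: 1. $\overline g$ is Einstein if and only if there are constants $k_*,\overline k\in\mathbb R$ such that $g_*$ is Einstein with normalized Einstein constant $k_*$ and $k_*f^2-\varepsilon (f')^2=\overline k$ on $J$. 2. If $g_*$ is Einstein with normalized Einstein constant $k_*$ and $\overline k\in\mathbb R$, then $k_*f^2-\varepsilon (f')^2=\overline k$ holds on $J$ if and only if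 $\overline g$ is Einstein with normalized Einstein constant $\overline k$. 3. For every $k_*\in\mathbb R$: the function $k_*f^2-\varepsilon (f')^2$ is constant on $J$ if and only if $f''=\varepsilon k_*f$ on $J$. 4. (Explicit solutions for $\varepsilon=1$.) Let $U$ be an open interval containing $0$ and let $h$ be a $C^2$ function on $U$ (zeros allowed). Consider the pair of equations $k_*h^2-(h')^2=\overline k$ and $h''=k_*h$ on $U$. - With $h(0)=1$, $h'(0)=0$: for $\overline k=1,-1,0$, respectively, the pair of equations holds if and only if $k_*=1$ and $h=\cosh t$; $k_*=-1$ and $h=\cos t$; $k_*=0$ and $h=1$, respectively. - With $h(0)=h'(0)=1$: for $\overline k=0,-1,1$, respectively, it holds if and only if $k_*=1$ and $h=e^t$; $k_*=0$ and $h=t+1$; $k_*=2$ and $h=\frac1{2\sqrt2}\big[(\sqrt2+1)e^{\sqrt2\,t}+(\sqrt2-1)e^{-\sqrt2\,t}\big]$, respectively. - With $h(0)=0$, $h'(0)=1$: for $k_*=1,-1,0$, respectively, it holds if and only if $\overline k=-1$ and $h=\sinh t$, $h=\sin t$, $h=t$, respectively. - With $h(0)=h'(0)=0$: it holds if and only if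 $\overline k=0$ and $h=0$. -/

import Mathlib

open scoped Manifold ContDiff

set_option maxSynthPendingDepth 3

noncomputable section

namespace PseudoRiemannian

section Bilinear

set_option linter.unusedSectionVars false

variable {V W : Type*} [AddCommGroup V] [Module ℝ V] [TopologicalSpace V] [IsTopologicalAddGroup V]
  [ContinuousConstSMul ℝ V] [AddCommGroup W] [Module ℝ W] [TopologicalSpace W] [IsTopologicalAddGroup W]
  [ContinuousConstSMul ℝ W]

/-- The pullback `(u, v) ↦ B (A u) (A v)` of a bilinear form `B` by a linear map `A`. -/
def pullback (B : V →L[ℝ] V →L[ℝ] ℝ) (A : W →L[ℝ] V) : W →L[ℝ] W →L[ℝ] ℝ :=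
  (ContinuousLinearMap.precomp ℝ A) ∘L (B ∘L A)

@[simp]
theorem pullback_apply (B : V →L[ℝ] V →L[ℝ] ℝ) (A : W →L[ℝ] V) (u v : W) :
    pullback B A u v = B (A u) (A v) := rfl

end Bilinear

section Coordinates

variable {E : Type*} [NormedAddCommGroup E] [NormedSpace ℝ E]

/-- Christoffel symbols of the first kind of a metric `G` given on (an open subset of) the vector
space `E`: `[u v, w] = (∂_u G(v, w) + ∂_v G(u, w) - ∂_w G(u, v)) / 2`. -/
def christoffelFirst (G : E → E →L[ℝ] E →L[ℝ] ℝ) (y : E) : E →L[ℝ] E →L[ℝ] E →L[ℝ] ℝ :=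
  (1 / 2 : ℝ) • (fderiv ℝ G y + (fderiv ℝ G y).flip -
    (ContinuousLinearMap.flipₗᵢ ℝ E E ℝ).toContinuousLinearEquiv.toContinuousLinearMap ∘L
      (fderiv ℝ G y).flip)

theorem christoffelFirst_apply (G : E → E →L[ℝ] E →L[ℝ] ℝ) (y u v w : E) :
    christoffelFirst G y u v w =
      (fderiv ℝ G y u v w + fderiv ℝ G y v u w - fderiv ℝ G y w u v) / 2 := by
  simp [christoffelFirst]; ring

/-- Christoffel symbols of the second kind: `Γ(u, v) = ∇_u v` for constant vector fields `u, v`,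
where `∇` is the Levi-Civita connection of `G`; it is obtained from the symbols of the first kind by
raising the last index, that is `G(Γ(u, v), w) = [u v, w]`. -/
def christoffel (G : E → E →L[ℝ] E →L[ℝ] ℝ) (y : E) : E →L[ℝ] E →L[ℝ] E :=
  (ContinuousLinearMap.compL ℝ E (E →L[ℝ] ℝ) E (G y).inverse) ∘L (christoffelFirst G y)

theorem christoffel_apply (G : E → E →L[ℝ] E →L[ℝ] ℝ) (y u v : E) :
    christoffel G y u v = (G y).inverse (christoffelFirst G y u v) := rfl

/-- The curvature tensor `R(u, v) w = ∇_u ∇_v w - ∇_v ∇_u w - ∇_{[u, v]} w` of `G`, written for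
constant vector fields `u, v, w`. -/
def curvature (G : E → E →L[ℝ] E →L[ℝ] ℝ) (y u v w : E) : E :=
  fderiv ℝ (christoffel G) y u v w - fderiv ℝ (christoffel G) y v u w
    + christoffel G y u (christoffel G y v w) - christoffel G y v (christoffel G y u w)

/-- The Ricci tensor `Ric(u, v) = trace (w ↦ R(w, u) v)` of `G`. -/
def ricci (G : E → E →L[ℝ] E →L[ℝ] ℝ) (y u v : E) : ℝ :=
  LinearMap.trace ℝ E
    { toFun := fun w => curvature G y w u v
      map_add' := by
        intro a b
        simp only [curvature, map_add, add_apply]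
        abel
      map_smul' := by
        intro c a
        simp only [curvature, map_smul, smul_apply,
          RingHom.id_apply, smul_sub, smul_add] }

end Coordinates

section Manifold

variable {E : Type*} [NormedAddCommGroup E] [NormedSpace ℝ E]
  {H : Type*} [TopologicalSpace H] {I : ModelWithCorners ℝ E H}
  {M : Type*} [TopologicalSpace M] [ChartedSpace H M]

/-- The coordinate expression of a field `g` of bilinear forms on the tangent spaces of a manifold
(without boundary) in the chart `e`: the pullback of `g` by the inverse of `e`. -/
def inChart (g : ∀ x : M, TangentSpace I x →L[ℝ] TangentSpace I x →L[ℝ] ℝ)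
    (e : OpenPartialHomeomorph M H) : E → E →L[ℝ] E →L[ℝ] ℝ := fun y =>
  pullback (g ((e.extend I).symm y)) (mfderiv 𝓘(ℝ, E) I (e.extend I).symm y)

end Manifold

section Metric

variable {E : Type*} [NormedAddCommGroup E] [NormedSpace ℝ E]
  {H : Type*} [TopologicalSpace H] (I : ModelWithCorners ℝ E H)
  (M : Type*) [TopologicalSpace M] [ChartedSpace H M]

/-- A pseudo-Riemannian metric (of arbitrary signature) on a manifold without boundary of class
`C^4`: a field of nondegenerate symmetric bilinear forms on the tangent spaces whose coefficients in
every chart are of class `C^3`. -/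
structure Metric where
  /-- the bilinear form on the tangent space at each point -/
  val (x : M) : TangentSpace I x →L[ℝ] TangentSpace I x →L[ℝ] ℝ
  symm (x : M) (u v : TangentSpace I x) : val x u v = val x v u
  nondegenerate (x : M) (u : TangentSpace I x) (hu : ∀ v, val x u v = 0) : u = 0
  contDiffOn (e : OpenPartialHomeomorph M H) (he : e ∈ atlas H M) :
    ContDiffOn ℝ 3 (inChart val e) (e.extend I).target

end Metric

namespace Metric

variable {E : Type*} [NormedAddCommGroup E] [NormedSpace ℝ E]
  {H : Type*} [TopologicalSpace H] {I : ModelWithCorners ℝ E H}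
  {M : Type*} [TopologicalSpace M] [ChartedSpace H M]

/-- `Ric = lam • g` for a function `lam` on the manifold (an identity of tensor fields, expressed
in all charts). -/
def RicciEq (g : Metric I M) (lam : M → ℝ) : Prop :=
  ∀ e ∈ atlas H M, ∀ y ∈ (e.extend I).target, ∀ u v : E,
    ricci (inChart g.val e) y u v = lam ((e.extend I).symm y) * inChart g.val e y u v

/-- Einstein metrics: `Ric = lam • g` for some function `lam`, where in dimension two `lam`
(the Gaussian curvature) is moreover required to be constant. -/
def IsEinstein (g : Metric I M) : Prop :=
  ∃ lam : M → ℝ, g.RicciEq lam ∧ (Module.finrank ℝ E = 2 → ∃ c, ∀ x, lam x = c)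

/-- `g` is an Einstein metric on a manifold of dimension `m` whose normalized Einstein constant
is `k`, that is `Ric = (m - 1) k g`. -/
def IsEinsteinWith (g : Metric I M) (k : ℝ) : Prop :=
  g.RicciEq fun _ => ((Module.finrank ℝ E : ℝ) - 1) * k

theorem IsEinsteinWith.isEinstein {g : Metric I M} {k : ℝ} (h : g.IsEinsteinWith k) :
    g.IsEinstein :=
  ⟨_, h, fun _ => ⟨_, fun _ => rfl⟩⟩

end Metric

section Product

open TopologicalSpace

variable {E : Type*} [NormedAddCommGroup E] [NormedSpace ℝ E]
  {M : Type*} [TopologicalSpace M] [ChartedSpace E M]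

/-- The coordinate function `t` on `J × M`. -/
def timeCoord (J : Opens ℝ) (M : Type*) : J × M → ℝ := fun p => (p.1 : ℝ)

/-- The one-form `dt` on `J × M`. -/
def dt (J : Opens ℝ) (p : J × M) : TangentSpace (𝓘(ℝ, ℝ).prod 𝓘(ℝ, E)) p →L[ℝ] ℝ :=
  mfderiv (𝓘(ℝ, ℝ).prod 𝓘(ℝ, E)) 𝓘(ℝ, ℝ) (timeCoord J M) p

/-- The field of bilinear forms `f(t)⁻² (ε dt² + g)` on `J × M`. -/
def conformalProductForm (J : Opens ℝ) (ε : ℝ) (f : ℝ → ℝ)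
    (g : ∀ x : M, TangentSpace 𝓘(ℝ, E) x →L[ℝ] TangentSpace 𝓘(ℝ, E) x →L[ℝ] ℝ) (p : J × M) :
    TangentSpace (𝓘(ℝ, ℝ).prod 𝓘(ℝ, E)) p →L[ℝ] TangentSpace (𝓘(ℝ, ℝ).prod 𝓘(ℝ, E)) p →L[ℝ] ℝ :=
  ((f (timeCoord J M p)) ^ 2)⁻¹ •
    (ε • pullback (ContinuousLinearMap.mul ℝ ℝ) (dt J p)
      + pullback (g p.2) (mfderiv (𝓘(ℝ, ℝ).prod 𝓘(ℝ, E)) 𝓘(ℝ, E) Prod.snd p))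

theorem conformalProductForm_apply (J : Opens ℝ) (ε : ℝ) (f : ℝ → ℝ)
    (g : ∀ x : M, TangentSpace 𝓘(ℝ, E) x →L[ℝ] TangentSpace 𝓘(ℝ, E) x →L[ℝ] ℝ) (p : J × M)
    (u v : TangentSpace (𝓘(ℝ, ℝ).prod 𝓘(ℝ, E)) p) :
    conformalProductForm J ε f g p u v = ((f p.1) ^ 2)⁻¹ *
      (ε * (dt J p u * dt J p v) +
        g p.2 (mfderiv (𝓘(ℝ, ℝ).prod 𝓘(ℝ, E)) 𝓘(ℝ, E) Prod.snd p u)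
          (mfderiv (𝓘(ℝ, ℝ).prod 𝓘(ℝ, E)) 𝓘(ℝ, E) Prod.snd p v)) := rfl

theorem mem_atlas_opens {J : Opens ℝ} {e : OpenPartialHomeomorph J ℝ} (he : e ∈ atlas ℝ J) :
    ∀ t ∈ e.target, ((e.symm t : J) : ℝ) = t := by
  obtain ⟨x, hx⟩ := Set.mem_iUnion.1 he
  rw [Set.mem_singleton_iff] at hx
  subst hx
  intro t ht
  exact OpenPartialHomeomorph.subtypeRestr_symm_apply (chartAt ℝ (x : ℝ)) ⟨x⟩ ht

/-- In product charts, `f(t)⁻² (ε dt² + g)` has the expected coefficients. -/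
theorem inChart_conformalProductForm [IsManifold 𝓘(ℝ, E) 4 M] {J : Opens ℝ} {ε : ℝ} {f : ℝ → ℝ}
    {g : ∀ x : M, TangentSpace 𝓘(ℝ, E) x →L[ℝ] TangentSpace 𝓘(ℝ, E) x →L[ℝ] ℝ}
    {e₁ : OpenPartialHomeomorph J ℝ} (h₁ : e₁ ∈ atlas ℝ J)
    {e₂ : OpenPartialHomeomorph M E} (h₂ : e₂ ∈ atlas E M)
    {y : ℝ × E} (hy₁ : y.1 ∈ e₁.target) (hy₂ : y.2 ∈ e₂.target) (u v : ℝ × E) :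
    inChart (conformalProductForm J ε f g) (e₁.prod e₂) y u v =
      (f y.1 ^ 2)⁻¹ * (ε * (u.1 * v.1) + inChart g e₂ y.2 u.2 v.2) := by
  have : IsManifold 𝓘(ℝ, E) 1 M := IsManifold.of_le (n := 4) (by norm_num)
  let φ : ℝ × E → J × M := Prod.map e₁.symm e₂.symm
  have d₁ : MDifferentiableAt 𝓘(ℝ, ℝ) 𝓘(ℝ, ℝ) e₁.symm y.1 :=
    ((contMDiffOn_symm_of_mem_maximalAtlas (n := 1) (I := 𝓘(ℝ, ℝ))
      (StructureGroupoid.subset_maximalAtlas _ h₁)).contMDiffAt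
      (e₁.open_target.mem_nhds hy₁)).mdifferentiableAt one_ne_zero
  have d₂ : MDifferentiableAt 𝓘(ℝ, E) 𝓘(ℝ, E) e₂.symm y.2 :=
    ((contMDiffOn_symm_of_mem_maximalAtlas (n := 1) (I := 𝓘(ℝ, E))
      (StructureGroupoid.subset_maximalAtlas _ h₂)).contMDiffAt
      (e₂.open_target.mem_nhds hy₂)).mdifferentiableAt one_ne_zero
  have dφ : MDifferentiableAt 𝓘(ℝ, ℝ × E) (𝓘(ℝ, ℝ).prod 𝓘(ℝ, E)) φ y := by
    rw [modelWithCornersSelf_prod, ← chartedSpaceSelf_prod]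
    exact MDifferentiableAt.prodMap (x := y.1) (y := y.2) d₁ d₂
  have ht : ((φ y).1 : ℝ) = y.1 := mem_atlas_opens h₁ _ hy₁
  have dT : MDifferentiableAt (𝓘(ℝ, ℝ).prod 𝓘(ℝ, E)) 𝓘(ℝ, ℝ) (timeCoord J M) (φ y) :=
    ((contMDiff_subtype_val (n := 1)).comp contMDiff_fst).mdifferentiableAt one_ne_zero
  have hT : ∀ w : ℝ × E, dt J (φ y)
      (mfderiv 𝓘(ℝ, ℝ × E) (𝓘(ℝ, ℝ).prod 𝓘(ℝ, E)) φ y w) = w.1 := by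
    intro w
    refine (mfderiv_comp_apply y dT dφ w).symm.trans ?_
    have : (timeCoord J M ∘ φ) =ᶠ[nhds y] Prod.fst := by
      filter_upwards [(e₁.open_target.prod e₂.open_target).mem_nhds
        (show y ∈ e₁.target ×ˢ e₂.target from ⟨hy₁, hy₂⟩)] with z hz
      exact mem_atlas_opens h₁ _ hz.1
    rw [this.mfderiv_eq, mfderiv_eq_fderiv, fderiv_fst]
    rfl
  have hP : ∀ w : ℝ × E, mfderiv (𝓘(ℝ, ℝ).prod 𝓘(ℝ, E)) 𝓘(ℝ, E) Prod.snd (φ y)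
      (mfderiv 𝓘(ℝ, ℝ × E) (𝓘(ℝ, ℝ).prod 𝓘(ℝ, E)) φ y w) =
      mfderiv 𝓘(ℝ, E) 𝓘(ℝ, E) e₂.symm y.2 w.2 := by
    intro w
    rw [← mfderiv_comp_apply y mdifferentiableAt_snd dφ w]
    have : (Prod.snd ∘ φ) = e₂.symm ∘ Prod.snd := rfl
    rw [this, mfderiv_comp_apply y d₂ (differentiableAt_snd.mdifferentiableAt) w,
      mfderiv_eq_fderiv, fderiv_snd]
    rfl
  have h := conformalProductForm_apply J ε f g (φ y)
    (mfderiv 𝓘(ℝ, ℝ × E) (𝓘(ℝ, ℝ).prod 𝓘(ℝ, E)) φ y u)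
    (mfderiv 𝓘(ℝ, ℝ × E) (𝓘(ℝ, ℝ).prod 𝓘(ℝ, E)) φ y v)
  rw [hT, hT, hP, hP, ht] at h
  exact h

theorem dt_injective (J : Opens ℝ) (p : J × M) (w : ℝ × E)
    (h : dt (E := E) J p w = 0) : w.1 = 0 := by
  have h3 : dt (E := E) J p w = mfderiv 𝓘(ℝ, ℝ) 𝓘(ℝ, ℝ) (Subtype.val : J → ℝ) p.1 w.1 := by
    refine (mfderiv_comp_apply p ((contMDiff_subtype_val (n := 1)).mdifferentiableAt one_ne_zero)
      mdifferentiableAt_fst w).trans ?_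
    rw [mfderiv_fst]
    rfl
  have hi := isInvertible_mfderiv_extChartAt (I := 𝓘(ℝ, ℝ))
    (mem_extChartAt_source (I := 𝓘(ℝ, ℝ)) p.1)
  have hv : (extChartAt 𝓘(ℝ, ℝ) p.1 : J → ℝ) = Subtype.val := rfl
  rw [hv] at hi
  exact hi.injective ((h3.symm.trans h).trans (map_zero _).symm)

theorem dt_vertical (J : Opens ℝ) (p : J × M) (w : E) :
    dt (E := E) J p ((0, w) : ℝ × E) = 0 := by
  refine (mfderiv_comp_apply p ((contMDiff_subtype_val (n := 1)).mdifferentiableAt one_ne_zero)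
    mdifferentiableAt_fst ((0, w) : ℝ × E)).trans ?_
  rw [mfderiv_fst]
  exact map_zero _

/-- The metric `f(t)⁻² (ε dt² + g)` on `J × M`, where `J` is open in `ℝ` and `f` has no zero
on `J`. -/
def conformalProduct [IsManifold 𝓘(ℝ, E) 4 M] (J : Opens ℝ) (ε : ℝ) (hε : ε = 1 ∨ ε = -1)
    (f : ℝ → ℝ) (hf : ContDiffOn ℝ 4 f J) (hf0 : ∀ t ∈ J, f t ≠ 0) (g : Metric 𝓘(ℝ, E) M) :
    Metric (𝓘(ℝ, ℝ).prod 𝓘(ℝ, E)) (J × M) where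
  val := conformalProductForm J ε f g.val
  symm p u v := by
    rw [conformalProductForm_apply, conformalProductForm_apply, g.symm, mul_comm (dt J p u)]
  nondegenerate p u hu := by
    have hε0 : ε ≠ 0 := by rcases hε with rfl | rfl <;> norm_num
    have hf1 : ((f p.1) ^ 2)⁻¹ ≠ 0 := inv_ne_zero (pow_ne_zero _ (hf0 _ p.1.2))
    have key : ∀ v : ℝ × E, ε * (dt J p u * dt (E := E) J p v) + g.val p.2 u.2 v.2 = 0 := by
      intro v
      have h := (conformalProductForm_apply J ε f g.val p u v).symm.trans (hu v)
      have h2 := (mul_eq_zero.1 h).resolve_left hf1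
      rw [mfderiv_snd] at h2
      exact h2
    have aux₁ : ∀ a b c : ℝ, b = 0 → ε * (a * b) + c = 0 → c = 0 := by
      rintro a _ c rfl h
      simpa using h
    have aux₂ : ∀ a c : ℝ, c = 0 → ε * (a * a) + c = 0 → a = 0 := by
      rintro a _ rfl h
      simpa [hε0] using h
    have h2 : u.2 = 0 :=
      g.nondegenerate p.2 u.2 fun v => aux₁ _ _ _ (dt_vertical (E := E) J p v) (key (0, v))
    have hc : g.val p.2 u.2 u.2 = 0 :=
      (congrArg (g.val p.2 u.2) h2).trans (map_zero (g.val p.2 u.2))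
    have h1 : u.1 = 0 := dt_injective J p u (aux₂ _ _ hc (key u))
    exact Prod.ext h1 h2
  contDiffOn := by
    rintro _ ⟨e₁, h₁, e₂, h₂, rfl⟩
    have htar : ((e₁.prod e₂).extend (𝓘(ℝ, ℝ).prod 𝓘(ℝ, E))).target
        = e₁.target ×ˢ e₂.target := by
      rw [OpenPartialHomeomorph.extend_prod]
      simp [mfld_simps]
    rw [htar]
    have hcoord : ContDiffOn ℝ 3 (fun y : ℝ × E => (f y.1 ^ 2)⁻¹ •
        (ε • pullback (ContinuousLinearMap.mul ℝ ℝ) (ContinuousLinearMap.fst ℝ ℝ E) +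
          pullback (inChart g.val e₂ y.2) (ContinuousLinearMap.snd ℝ ℝ E)))
        (e₁.target ×ˢ e₂.target) := by
      have hJ : ∀ t ∈ e₁.target, t ∈ J := fun t ht => by
        rw [← mem_atlas_opens h₁ t ht]; exact (e₁.symm t).2
      have hg : ContDiffOn ℝ 3 (inChart g.val e₂) e₂.target := by
        simpa [mfld_simps] using g.contDiffOn e₂ h₂
      have hf3 : ContDiffOn ℝ 3 f J := hf.of_le (by norm_num)
      have hf' : ContDiffOn ℝ 3 (fun y : ℝ × E => f y.1) (e₁.target ×ˢ e₂.target) :=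
        hf3.comp contDiff_fst.contDiffOn fun y hy => hJ _ hy.1
      refine ContDiffOn.smul ((hf'.pow 2).inv fun y hy => pow_ne_zero _ (hf0 _ (hJ _ hy.1))) ?_
      refine contDiffOn_const.add ?_
      exact contDiffOn_const.clm_comp
        ((hg.comp contDiff_snd.contDiffOn fun y hy => hy.2).clm_comp contDiffOn_const)
    refine hcoord.congr fun y hy => ?_
    refine ContinuousLinearMap.ext fun u => ContinuousLinearMap.ext fun v => ?_
    rw [inChart_conformalProductForm h₁ h₂ hy.1 hy.2]
    rfl

end Product

/-- On the set `J`, the function `h` satisfies `k h² - (h')² = kbar` and `h'' = k h`, with initial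
values `h 0 = a` and `h' 0 = b` (the equations in the Riemannian case `ε = 1`). -/
structure SolvesIVP (J : Set ℝ) (h : ℝ → ℝ) (k kbar a b : ℝ) : Prop where
  first_order : ∀ t ∈ J, k * h t ^ 2 - deriv h t ^ 2 = kbar
  second_order : ∀ t ∈ J, deriv (deriv h) t = k * h t
  value_zero : h 0 = a
  deriv_zero : deriv h 0 = b

end PseudoRiemannian

end

/-!
The proof computes the Ricci tensor of `f⁻² (ε dt² + g)` directly in product coordinates `(t, x)`.
With `φ = f⁻²`, `a = φ' / (2 φ) = -f' / f` and `Γ` the Christoffel symbols of `g`, those of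
`φ (ε dt² + g)` are
`(u, v) ↦ (a (u₁ v₁ - ε g(u₂, v₂)), a u₁ v₂ + a v₁ u₂ + Γ(u₂, v₂))` (`christoffel_productForm`).
Differentiating once more and taking the trace block by block gives, in dimension `n + 1`,
`Ric(u, v) = Ric_g(u₂, v₂) - n a' u₁ v₁ - ε (a' + (n - 1) a²) g(u₂, v₂)` (`ricci_productForm`).
Hence `Ric = lam • f⁻² (ε dt² + g)` splits into the two equations
`n (f f'' - f'²) = ε lam` and `f² Ric_g = (lam - ε (f f'' - n f'²)) g`
(`ricciEq_conformalProduct_iff`).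

Eliminating `lam` leaves `Ric_g = (n - 1) (ε f'' / f) g`, in which the coefficient of `g` depends on
`t` and everything else on `x`. So `g` is Einstein and `f'' = ε k f` for a constant `k`; Schur's
lemma is not needed. Conversely, if `g` is Einstein, both equations follow from
`k f² - ε f'² = kbar` together with `f'' = ε k f`.

These two equations for `f` are equivalent up to the choice of `kbar`
(`first_order_iff_second_order`). Differentiation of the first gives the second only where
`f' ≠ 0`; that it holds everywhere uses that `f` has no zeros and is not constant on an interval.

The explicit solutions come from uniqueness for the linear equation `h'' = k h`, together with the
value at `0` of the first integral `k h² - h'²` (`solvesIVP_iff`).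
-/

namespace PseudoRiemannian

/-! ### The second order equation `h'' = k h` -/

theorem hasDerivAt_of_contDiffOn_two {h : ℝ → ℝ} {U : Set ℝ} (hU : IsOpen U)
    (hh : ContDiffOn ℝ 2 h U) {t : ℝ} (ht : t ∈ U) : HasDerivAt h (deriv h t) t :=
  ((hh.differentiableOn (by norm_num)).differentiableAt (hU.mem_nhds ht)).hasDerivAt

theorem hasDerivAt_deriv_of_contDiffOn_two {h : ℝ → ℝ} {U : Set ℝ} (hU : IsOpen U)
    (hh : ContDiffOn ℝ 2 h U) {t : ℝ} (ht : t ∈ U) :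
    HasDerivAt (deriv h) (deriv (deriv h) t) t := by
  have h1 : ContDiffOn ℝ 1 (deriv h) U := hh.deriv_of_isOpen hU (by norm_num)
  exact ((h1.differentiableOn (by norm_num)).differentiableAt (hU.mem_nhds ht)).hasDerivAt

theorem continuousOn_deriv_deriv {h : ℝ → ℝ} {U : Set ℝ} (hU : IsOpen U)
    (hh : ContDiffOn ℝ 2 h U) : ContinuousOn (deriv (deriv h)) U := by
  have h1 : ContDiffOn ℝ 1 (deriv h) U := hh.deriv_of_isOpen hU (by norm_num)
  exact (h1.deriv_of_isOpen (m := 0) hU (by norm_num)).continuousOn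

theorem eq_of_hasDerivAt_zero {F : ℝ → ℝ} {U : Set ℝ} (hU : IsOpen U) (hc : U.OrdConnected)
    (hF : ∀ t ∈ U, HasDerivAt F 0 t) {s t : ℝ} (hs : s ∈ U) (ht : t ∈ U) : F s = F t :=
  hU.is_const_of_deriv_eq_zero hc.isPreconnected
    (fun r hr => (hF r hr).differentiableAt.differentiableWithinAt)
    (fun r hr => (hF r hr).deriv) hs ht

theorem exists_Ioo_subset {U : Set ℝ} (hU : IsOpen U) (hc : U.OrdConnected) {s t : ℝ}
    (hs : s ∈ U) (ht : t ∈ U) : ∃ a b, s ∈ Set.Ioo a b ∧ t ∈ Set.Ioo a b ∧ Set.Ioo a b ⊆ U := by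
  have hmin : min s t ∈ U := by rcases min_choice s t with h | h <;> rw [h] <;> assumption
  have hmax : max s t ∈ U := by rcases max_choice s t with h | h <;> rw [h] <;> assumption
  obtain ⟨a, ha, haU⟩ := exists_Ioc_subset_of_mem_nhds (hU.mem_nhds hmin) ⟨_, sub_one_lt _⟩
  obtain ⟨b, hb, hbU⟩ := exists_Ico_subset_of_mem_nhds (hU.mem_nhds hmax) ⟨_, lt_add_one _⟩
  refine ⟨a, b, ⟨ha.trans_le (min_le_left _ _), (le_max_left _ _).trans_lt hb⟩,
    ⟨ha.trans_le (min_le_right _ _), (le_max_right _ _).trans_lt hb⟩, fun r hr => ?_⟩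
  rcases le_total r (min s t) with h | h
  · exact haU ⟨hr.1, h⟩
  rcases le_total r (max s t) with h' | h'
  · exact hc.out hmin hmax ⟨h, h'⟩
  · exact hbU ⟨h', hr.2⟩

/-- Uniqueness for the initial value problem `h'' = k h`, by passing to the first order system for
`(h, h')`. -/
theorem eqOn_of_second_order {U : Set ℝ} (hU : IsOpen U) (hc : U.OrdConnected) (h0 : (0 : ℝ) ∈ U)
    {k : ℝ} {p p' q q' : ℝ → ℝ} (hp : ∀ t ∈ U, HasDerivAt p (p' t) t)
    (hp' : ∀ t ∈ U, HasDerivAt p' (k * p t) t) (hq : ∀ t ∈ U, HasDerivAt q (q' t) t)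
    (hq' : ∀ t ∈ U, HasDerivAt q' (k * q t) t) (h₀ : p 0 = q 0) (h₁ : p' 0 = q' 0) :
    ∀ t ∈ U, p t = q t := by
  intro t ht
  obtain ⟨a, b, h0ab, htab, hab⟩ := exists_Ioo_subset hU hc h0 ht
  let A : ℝ × ℝ →L[ℝ] ℝ × ℝ :=
    (ContinuousLinearMap.snd ℝ ℝ ℝ).prod (k • ContinuousLinearMap.fst ℝ ℝ ℝ)
  have key := ODE_solution_unique_of_mem_Ioo (v := fun _ => A) (s := fun _ => Set.univ)
    (f := fun t => (p t, p' t)) (g := fun t => (q t, q' t)) (K := ‖A‖₊) (a := a) (b := b)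
    (fun _ _ => A.lipschitz.lipschitzOnWith) h0ab
    (fun r hr => ⟨(hp r (hab hr)).prodMk (hp' r (hab hr)), trivial⟩)
    (fun r hr => ⟨(hq r (hab hr)).prodMk (hq' r (hab hr)), trivial⟩)
    (Prod.ext h₀ h₁)
  exact congrArg Prod.fst (key htab)

theorem SolvesIVP.kbar_eq {U : Set ℝ} {h : ℝ → ℝ} {k kbar a b : ℝ} (h0 : (0 : ℝ) ∈ U)
    (H : SolvesIVP U h k kbar a b) : k * a ^ 2 - b ^ 2 = kbar := by
  rw [← H.first_order 0 h0, H.value_zero, H.deriv_zero]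

/-- If `c` solves `c'' = k c` on the line, then the solutions `h` of the pair of equations with the
initial values of `c` are the restrictions of `c`, and `kbar` is read off at `0`. -/
theorem solvesIVP_iff {U : Set ℝ} {h : ℝ → ℝ} (hU : IsOpen U) (hc : U.OrdConnected)
    (h0 : (0 : ℝ) ∈ U) (hh : ContDiffOn ℝ 2 h U) {k a b : ℝ} (kbar : ℝ) (c c' : ℝ → ℝ)
    (hd : ∀ t, HasDerivAt c (c' t) t) (hd' : ∀ t, HasDerivAt c' (k * c t) t)
    (ha : c 0 = a) (hb : c' 0 = b) :
    SolvesIVP U h k kbar a b ↔ kbar = k * a ^ 2 - b ^ 2 ∧ ∀ t ∈ U, h t = c t := by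
  constructor
  · intro H
    refine ⟨?_, eqOn_of_second_order hU hc h0
      (fun t ht => hasDerivAt_of_contDiffOn_two hU hh ht) (fun t ht => ?_)
      (fun t _ => hd t) (fun t _ => hd' t) (H.value_zero.trans ha.symm)
      (H.deriv_zero.trans hb.symm)⟩
    · exact (H.kbar_eq h0).symm
    · rw [← H.second_order t ht]
      exact hasDerivAt_deriv_of_contDiffOn_two hU hh ht
  · rintro ⟨rfl, H⟩
    have e1 : ∀ t ∈ U, deriv h t = c' t := fun t ht =>
      ((hd t).congr_of_eventuallyEq (Filter.eventually_of_mem (hU.mem_nhds ht) H)).deriv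
    have e2 : ∀ t ∈ U, deriv (deriv h) t = k * c t := fun t ht =>
      ((hd' t).congr_of_eventuallyEq (Filter.eventually_of_mem (hU.mem_nhds ht) e1)).deriv
    refine ⟨fun t ht => ?_, fun t ht => by rw [e2 t ht, H t ht], by rw [H 0 h0, ha],
      by rw [e1 0 h0, hb]⟩
    have hconst : ∀ t ∈ U, HasDerivAt (fun t => k * c t ^ 2 - c' t ^ 2) 0 t := fun t _ => by
      have := (((hd t).pow 2).const_mul k).sub ((hd' t).pow 2)
      refine this.congr_deriv ?_
      simp only [Nat.cast_ofNat]
      ring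
    have := eq_of_hasDerivAt_zero hU hc hconst ht h0
    rw [H t ht, e1 t ht, ← ha, ← hb]
    exact this

/-- When the initial value `a` is nonzero, `k` is determined by `kbar` and the initial values. -/
theorem solvesIVP_iff_of_ne_zero {U : Set ℝ} {h : ℝ → ℝ} (hU : IsOpen U) (hc : U.OrdConnected)
    (h0 : (0 : ℝ) ∈ U) (hh : ContDiffOn ℝ 2 h U) {a b : ℝ} (ha0 : a ≠ 0) {kbar k₀ : ℝ}
    (hk₀ : kbar = k₀ * a ^ 2 - b ^ 2) (c c' : ℝ → ℝ)
    (hd : ∀ t, HasDerivAt c (c' t) t) (hd' : ∀ t, HasDerivAt c' (k₀ * c t) t)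
    (ha : c 0 = a) (hb : c' 0 = b) (k : ℝ) :
    SolvesIVP U h k kbar a b ↔ k = k₀ ∧ ∀ t ∈ U, h t = c t := by
  have aux := solvesIVP_iff hU hc h0 hh kbar c c' hd hd' ha hb
  constructor
  · intro H
    have hk : k = k₀ := by
      have h1 := H.kbar_eq h0
      have h2 : (k - k₀) * a ^ 2 = 0 := by linarith
      exact sub_eq_zero.1 ((mul_eq_zero.1 h2).resolve_right (pow_ne_zero 2 ha0))
    subst hk
    exact ⟨rfl, (aux.1 H).2⟩
  · rintro ⟨rfl, H⟩
    exact aux.2 ⟨hk₀, H⟩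

/-- The explicit solutions for `kbar ∈ {1, -1, 0}` and the initial values `(1, 0)`, `(1, 1)`,
`(0, 1)` and `(0, 0)`. -/
theorem solvesIVP_explicit (U : Set ℝ) (h : ℝ → ℝ) (hU : IsOpen U) (hc : U.OrdConnected)
    (h0 : (0 : ℝ) ∈ U) (hh : ContDiffOn ℝ 2 h U) :
    (∀ k : ℝ, SolvesIVP U h k 1 1 0 ↔ k = 1 ∧ ∀ t ∈ U, h t = Real.cosh t) ∧
    (∀ k : ℝ, SolvesIVP U h k (-1) 1 0 ↔ k = -1 ∧ ∀ t ∈ U, h t = Real.cos t) ∧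
    (∀ k : ℝ, SolvesIVP U h k 0 1 0 ↔ k = 0 ∧ ∀ t ∈ U, h t = 1) ∧
    (∀ k : ℝ, SolvesIVP U h k 0 1 1 ↔ k = 1 ∧ ∀ t ∈ U, h t = Real.exp t) ∧
    (∀ k : ℝ, SolvesIVP U h k (-1) 1 1 ↔ k = 0 ∧ ∀ t ∈ U, h t = t + 1) ∧
    (∀ k : ℝ, SolvesIVP U h k 1 1 1 ↔ k = 2 ∧ ∀ t ∈ U, h t = 1 / (2 * √2) *
      ((√2 + 1) * Real.exp (√2 * t) + (√2 - 1) * Real.exp (-√2 * t))) ∧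
    (∀ kbar : ℝ, SolvesIVP U h 1 kbar 0 1 ↔ kbar = -1 ∧ ∀ t ∈ U, h t = Real.sinh t) ∧
    (∀ kbar : ℝ, SolvesIVP U h (-1) kbar 0 1 ↔ kbar = -1 ∧ ∀ t ∈ U, h t = Real.sin t) ∧
    (∀ kbar : ℝ, SolvesIVP U h 0 kbar 0 1 ↔ kbar = -1 ∧ ∀ t ∈ U, h t = t) ∧
    (∀ k kbar : ℝ, SolvesIVP U h k kbar 0 0 ↔ kbar = 0 ∧ ∀ t ∈ U, h t = 0) := by
  refine ⟨?_, ?_, ?_, ?_, ?_, ?_, ?_, ?_, ?_, ?_⟩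
  · refine solvesIVP_iff_of_ne_zero hU hc h0 hh one_ne_zero (by norm_num) Real.cosh Real.sinh
      Real.hasDerivAt_cosh (fun t => ?_) Real.cosh_zero Real.sinh_zero
    simpa using Real.hasDerivAt_sinh t
  · refine solvesIVP_iff_of_ne_zero hU hc h0 hh one_ne_zero (by norm_num) Real.cos
      (fun t => -Real.sin t) Real.hasDerivAt_cos (fun t => ?_) Real.cos_zero (by simp)
    exact (Real.hasDerivAt_sin t).neg.congr_deriv (by ring)
  · exact solvesIVP_iff_of_ne_zero hU hc h0 hh one_ne_zero (by norm_num) (fun _ => 1)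
      (fun _ => 0) (fun t => hasDerivAt_const t 1)
      (fun t => by simpa using hasDerivAt_const t (0 : ℝ)) rfl rfl
  · refine solvesIVP_iff_of_ne_zero hU hc h0 hh one_ne_zero (by norm_num) Real.exp Real.exp
      Real.hasDerivAt_exp (fun t => ?_) Real.exp_zero Real.exp_zero
    simpa using Real.hasDerivAt_exp t
  · exact solvesIVP_iff_of_ne_zero hU hc h0 hh one_ne_zero (by norm_num) (fun t => t + 1)
      (fun _ => 1) (fun t => (hasDerivAt_id t).add_const 1)
      (fun t => by simpa using hasDerivAt_const t (1 : ℝ)) (by norm_num) rfl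
  · have hs : √2 * √2 = 2 := Real.mul_self_sqrt (by norm_num)
    have hs0 : √2 ≠ 0 := by positivity
    have e : ∀ s t : ℝ, HasDerivAt (fun t => Real.exp (s * t)) (s * Real.exp (s * t)) t :=
      fun s t => by
        simpa [mul_comm] using (((hasDerivAt_id t).const_mul s).exp)
    refine solvesIVP_iff_of_ne_zero hU hc h0 hh one_ne_zero (by norm_num) _
      (fun t => 1 / (2 * √2) * ((√2 + 1) * (√2 * Real.exp (√2 * t)) +
        (√2 - 1) * (-√2 * Real.exp (-√2 * t))))
      (fun t => (((e (√2) t).const_mul _).add ((e (-√2) t).const_mul _)).const_mul _)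
      (fun t => ?_) ?_ ?_
    · refine (((((e (√2) t).const_mul _).const_mul _).add
        (((e (-√2) t).const_mul _).const_mul _)).const_mul _).congr_deriv ?_
      linear_combination (1 / (2 * √2) * ((√2 + 1) * Real.exp (√2 * t) +
        (√2 - 1) * Real.exp (-√2 * t))) * hs
    · simp only [mul_zero, Real.exp_zero]
      field_simp
      ring
    · simp only [mul_zero, Real.exp_zero]
      field_simp
      ring
  · intro kbar
    have := solvesIVP_iff hU hc h0 hh (k := 1) kbar Real.sinh Real.cosh Real.hasDerivAt_sinh
      (fun t => by simpa using Real.hasDerivAt_cosh t) Real.sinh_zero Real.cosh_zero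
    simpa using this
  · intro kbar
    have := solvesIVP_iff hU hc h0 hh (k := -1) kbar Real.sin Real.cos Real.hasDerivAt_sin
      (fun t => by simpa using Real.hasDerivAt_cos t) Real.sin_zero Real.cos_zero
    simpa using this
  · intro kbar
    have := solvesIVP_iff hU hc h0 hh (k := 0) (a := 0) (b := 1) kbar (fun t => t) (fun _ => 1)
      hasDerivAt_id (fun t => by simpa using hasDerivAt_const t (1 : ℝ)) rfl rfl
    simpa using this
  · intro k kbar
    have := solvesIVP_iff hU hc h0 hh (k := k) (a := 0) (b := 0) kbar (fun _ => 0) (fun _ => 0)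
      (fun t => hasDerivAt_const t 0) (fun t => by simpa using hasDerivAt_const t (0 : ℝ)) rfl rfl
    simpa using this

/-! ### The first order equation -/

theorem hasDerivAt_first_order {J : Set ℝ} (hJo : IsOpen J) {f : ℝ → ℝ} (hf : ContDiffOn ℝ 2 f J)
    (k ε : ℝ) {t : ℝ} (ht : t ∈ J) :
    HasDerivAt (fun t => k * f t ^ 2 - ε * deriv f t ^ 2)
      (2 * deriv f t * (k * f t - ε * deriv (deriv f) t)) t := by
  refine ((((hasDerivAt_of_contDiffOn_two hJo hf ht).pow 2).const_mul k).sub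
    (((hasDerivAt_deriv_of_contDiffOn_two hJo hf ht).pow 2).const_mul ε)).congr_deriv ?_
  simp only [Nat.cast_ofNat]
  ring

/-- A non-constant function without zeros on an interval satisfies `k f² - ε (f')² = const` if and
only if it satisfies `f'' = ε k f`. Differentiating only gives `f' (f'' - ε k f) = 0`; for `k ≠ 0`
the set where the second factor is nonzero is also the set where `f''` vanishes, so it is both open
and closed, and `f` would be constant if it were everything. -/
theorem first_order_iff_second_order {J : Set ℝ} (hJo : IsOpen J) (hJ : J.OrdConnected)
    {ε : ℝ} (hε : ε = 1 ∨ ε = -1) {f : ℝ → ℝ} (hf : ContDiffOn ℝ 2 f J)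
    (hf0 : ∀ t ∈ J, f t ≠ 0) (hfc : ∃ s ∈ J, ∃ t ∈ J, f s ≠ f t) (k : ℝ) :
    (∃ kbar : ℝ, ∀ t ∈ J, k * f t ^ 2 - ε * deriv f t ^ 2 = kbar) ↔
      ∀ t ∈ J, deriv (deriv f) t = ε * k * f t := by
  have hε2 : ε * ε = 1 := by rcases hε with rfl | rfl <;> norm_num
  have hε0 : ε ≠ 0 := left_ne_zero_of_mul_eq_one hε2
  obtain ⟨s₀, hs₀, t₀, ht₀, hst⟩ := hfc
  have not_const : ¬ ∀ t ∈ J, deriv f t = 0 := fun h =>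
    hst (eq_of_hasDerivAt_zero hJo hJ
      (fun t ht => h t ht ▸ hasDerivAt_of_contDiffOn_two hJo hf ht) hs₀ ht₀)
  constructor
  · rintro ⟨kbar, H⟩
    have prod_zero : ∀ t ∈ J, deriv f t ≠ 0 → deriv (deriv f) t = ε * k * f t := by
      intro t ht h1
      have h2 : HasDerivAt (fun t => k * f t ^ 2 - ε * deriv f t ^ 2) 0 t :=
        (hasDerivAt_const t kbar).congr_of_eventuallyEq
          (Filter.eventually_of_mem (hJo.mem_nhds ht) H)
      have h3 := (hasDerivAt_first_order hJo hf k ε ht).unique h2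
      have h4 := (mul_eq_zero.1 h3).resolve_left (by simpa using h1)
      linear_combination -ε * h4 - deriv (deriv f) t * hε2
    rcases eq_or_ne k 0 with rfl | hk
    · intro t ht
      refine prod_zero t ht fun h1 => not_const fun r hr => ?_
      have h2 := (H r hr).trans (H t ht).symm
      rw [h1] at h2
      simpa [hε0] using h2
    · -- the second order equation fails where `D ≠ 0`; there `f'` vanishes, hence so does `f''`,
      -- while where `D = 0` one has `f'' = ε k f ≠ 0`
      let D : ℝ → ℝ := fun t => deriv (deriv f) t - ε * k * f t
      have hD : ContinuousOn D J :=
        (continuousOn_deriv_deriv hJo hf).sub (continuousOn_const.mul hf.continuousOn)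
      have hB : IsOpen (J ∩ {t | D t ≠ 0}) :=
        hD.isOpen_inter_preimage hJo isOpen_ne
      have hB' : IsOpen (J ∩ {t | deriv (deriv f) t ≠ 0}) :=
        (continuousOn_deriv_deriv hJo hf).isOpen_inter_preimage hJo isOpen_ne
      have d0 : ∀ t ∈ J ∩ {t | D t ≠ 0}, deriv f t = 0 := fun t ht => by
        by_contra h
        exact ht.2 (sub_eq_zero.2 (prod_zero t ht.1 h))
      have d1 : ∀ t ∈ J ∩ {t | D t ≠ 0}, deriv (deriv f) t = 0 := fun t ht => by
        have : deriv f =ᶠ[nhds t] fun _ => 0 := Filter.eventually_of_mem (hB.mem_nhds ht) d0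
        rw [this.deriv_eq, deriv_const]
      have hpre := hJ.isPreconnected.subset_or_subset hB hB'
        (Set.disjoint_left.2 fun t ht ht' => ht'.2 (d1 t ht))
        (fun t ht => by
          by_cases h : D t = 0
          · refine Or.inr ⟨ht, ?_⟩
            simp only [D, sub_eq_zero] at h
            change deriv (deriv f) t ≠ 0
            rw [h]
            exact mul_ne_zero (mul_ne_zero hε0 hk) (hf0 t ht)
          · exact Or.inl ⟨ht, h⟩)
      rcases hpre with h | h
      · exact absurd (fun t ht => d0 t (h ht)) not_const
      · intro t ht
        by_contra h1
        exact (h ht).2 (d1 t ⟨ht, fun h2 => h1 (sub_eq_zero.1 h2)⟩)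
  · intro H
    refine ⟨k * f s₀ ^ 2 - ε * deriv f s₀ ^ 2, fun t ht =>
      eq_of_hasDerivAt_zero (F := fun t => k * f t ^ 2 - ε * deriv f t ^ 2) hJo hJ
        (fun r hr => ?_) ht hs₀⟩
    refine (hasDerivAt_first_order hJo hf k ε hr).congr_deriv ?_
    rw [H r hr]
    linear_combination -2 * deriv f r * k * f r * hε2

/-! ### Christoffel symbols and curvature in coordinates -/

section Coordinates

variable {E : Type*} [NormedAddCommGroup E] [NormedSpace ℝ E]

theorem christoffel_congr {G G' : E → E →L[ℝ] E →L[ℝ] ℝ} {y : E} (h : G =ᶠ[nhds y] G') :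
    christoffel G y = christoffel G' y := by
  simp only [christoffel, christoffelFirst, h.fderiv_eq, h.eq_of_nhds]

theorem christoffel_eventuallyEq {G G' : E → E →L[ℝ] E →L[ℝ] ℝ} {y : E} (h : G =ᶠ[nhds y] G') :
    christoffel G =ᶠ[nhds y] christoffel G' :=
  h.eventuallyEq_nhds.mono fun _ => christoffel_congr

theorem ricci_congr {G G' : E → E →L[ℝ] E →L[ℝ] ℝ} {y : E} (h : G =ᶠ[nhds y] G') (u v : E) :
    ricci G y u v = ricci G' y u v := by
  have h1 : ∀ w u v, curvature G y w u v = curvature G' y w u v := fun w u v => by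
    simp only [curvature, (christoffel_eventuallyEq h).fderiv_eq, christoffel_congr h]
  simp only [ricci, h1]

/-- The linear map whose trace is the Ricci tensor. -/
theorem ricci_eq_trace (G : E → E →L[ℝ] E →L[ℝ] ℝ) (y u v : E) (L : E →ₗ[ℝ] E)
    (hL : ∀ w, L w = curvature G y w u v) : ricci G y u v = LinearMap.trace ℝ E L := by
  unfold ricci
  congr 1
  ext w
  exact (hL w).symm

/-- The defining property of the Christoffel symbols of the second kind. -/
theorem christoffel_eq_iff {G : E → E →L[ℝ] E →L[ℝ] ℝ} {y : E} (hG : (G y).IsInvertible)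
    {u v Γ : E} : christoffel G y u v = Γ ↔ ∀ w, G y Γ w = christoffelFirst G y u v w := by
  rw [christoffel_apply, ContinuousLinearMap.IsInvertible.inverse_apply_eq hG,
    ContinuousLinearMap.ext_iff]
  exact forall_congr' fun w => eq_comm

theorem apply_christoffel {G : E → E →L[ℝ] E →L[ℝ] ℝ} {y : E} (hG : (G y).IsInvertible)
    (u v w : E) : G y (christoffel G y u v) w = christoffelFirst G y u v w :=
  (christoffel_eq_iff hG).1 rfl w

theorem fderiv_apply_apply {F : Type*} [NormedAddCommGroup F] [NormedSpace ℝ F]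
    {B : F → E →L[ℝ] E →L[ℝ] E} {y : F} (hB : DifferentiableAt ℝ B y) (w : F) (u v : E) :
    fderiv ℝ B y w u v = fderiv ℝ (fun z => B z u v) y w := by
  have h := ((hB.hasFDerivAt.clm_apply (hasFDerivAt_const u y)).clm_apply (hasFDerivAt_const v y))
  rw [h.fderiv]
  simp

/-- The Christoffel symbols are symmetric where the metric is: the connection is torsion-free. -/
theorem christoffel_symm {G : E → E →L[ℝ] E →L[ℝ] ℝ} {y : E} (hd : DifferentiableAt ℝ G y)
    (hs : ∀ᶠ z in nhds y, ∀ u v, G z u v = G z v u) (u v : E) :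
    christoffel G y u v = christoffel G y v u := by
  have h : ∀ w, fderiv ℝ G y w u v = fderiv ℝ G y w v u := fun w => by
    have e : ∀ a b, fderiv ℝ G y w a b = fderiv ℝ (fun z => G z a b) y w := fun a b => by
      rw [((hd.hasFDerivAt.clm_apply (hasFDerivAt_const a y)).clm_apply
        (hasFDerivAt_const b y)).fderiv]
      simp
    have e' : (fun z => G z u v) =ᶠ[nhds y] fun z => G z v u := hs.mono fun z hz => hz u v
    rw [e, e, e'.fderiv_eq]
  rw [christoffel_apply, christoffel_apply]
  congr 1
  ext w
  rw [christoffelFirst_apply, christoffelFirst_apply, h w]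
  ring

variable [FiniteDimensional ℝ E]

/-- In finite dimension a nondegenerate form is an isomorphism onto the dual space. -/
theorem isInvertible_of_nondegenerate {B : E →L[ℝ] E →L[ℝ] ℝ}
    (hB : ∀ u, (∀ v, B u v = 0) → u = 0) : B.IsInvertible := by
  have hinj : Function.Injective (B : E →ₗ[ℝ] E →L[ℝ] ℝ) :=
    (injective_iff_map_eq_zero _).2 fun u hu => hB u fun v => congrArg (· v) hu
  have hrank : Module.finrank ℝ E = Module.finrank ℝ (E →L[ℝ] ℝ) := by
    rw [← (LinearMap.toContinuousLinearMap (𝕜 := ℝ) (E := E) (F' := ℝ)).finrank_eq]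
    exact (Subspace.dual_finrank_eq (K := ℝ) (V := E)).symm
  let L := LinearEquiv.ofInjectiveOfFinrankEq (B : E →ₗ[ℝ] E →L[ℝ] ℝ) hinj hrank
  refine ⟨L.toContinuousLinearEquiv, ?_⟩
  ext u v
  rfl

theorem christoffel_differentiableAt {G : E → E →L[ℝ] E →L[ℝ] ℝ} {y : E}
    (hG : ContDiffAt ℝ 2 G y) (hi : (G y).IsInvertible) :
    DifferentiableAt ℝ (christoffel G) y := by
  have h1 : ContDiffAt ℝ 1 (fderiv ℝ G) y := hG.fderiv_right (by norm_num)
  have h2 : ContDiffAt ℝ 1 (fun z => (G z).inverse) y :=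
    hi.contDiffAt_map_inverse.comp y (hG.of_le (by norm_num))
  have hflip : ContDiffAt ℝ 1 (fun z => (fderiv ℝ G z).flip) y :=
    (ContinuousLinearMap.flipₗᵢ ℝ E E (E →L[ℝ] ℝ)).contDiff.contDiffAt.comp y h1
  have hflip' : ContDiffAt ℝ 1 (fun z =>
      (ContinuousLinearMap.flipₗᵢ ℝ E E ℝ).toContinuousLinearEquiv.toContinuousLinearMap ∘L
        (fderiv ℝ G z).flip) y := contDiffAt_const.clm_comp hflip
  have h3 : ContDiffAt ℝ 1 (christoffelFirst G) y :=
    ((h1.add hflip).sub hflip').const_smul (1 / 2 : ℝ)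
  have h4 : ContDiffAt ℝ 1 (christoffel G) y :=
    (((ContinuousLinearMap.compL ℝ E (E →L[ℝ] ℝ) E).contDiff.contDiffAt.comp y h2)).clm_comp h3
  exact h4.differentiableAt (by norm_num)

/-- The trace of an endomorphism of `ℝ × E` in terms of its diagonal blocks. -/
theorem trace_real_prod (L : ℝ × E →ₗ[ℝ] ℝ × E) (L₂ : E →ₗ[ℝ] E)
    (hL₂ : ∀ w, L₂ w = (L (0, w)).2) :
    LinearMap.trace ℝ (ℝ × E) L = (L (1, 0)).1 + LinearMap.trace ℝ E L₂ := by
  have hsum : L = (L ∘ₗ LinearMap.inl ℝ ℝ E) ∘ₗ LinearMap.fst ℝ ℝ E +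
      (L ∘ₗ LinearMap.inr ℝ ℝ E) ∘ₗ LinearMap.snd ℝ ℝ E := by
    apply LinearMap.ext
    intro w
    simp [← map_add]
  have h1 : LinearMap.fst ℝ ℝ E ∘ₗ L ∘ₗ LinearMap.inl ℝ ℝ E = (L (1, 0)).1 • LinearMap.id := by
    ext
    simp
  have h2 : LinearMap.snd ℝ ℝ E ∘ₗ L ∘ₗ LinearMap.inr ℝ ℝ E = L₂ := by
    ext w
    simp [hL₂]
  calc LinearMap.trace ℝ (ℝ × E) L = _ := congrArg _ hsum
    _ = (L (1, 0)).1 + LinearMap.trace ℝ E L₂ := by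
      rw [map_add, LinearMap.trace_comp_comm', h1, LinearMap.trace_comp_comm', h2, map_smul,
        LinearMap.trace_id]
      simp

end Coordinates

/-! ### The Ricci tensor of `φ(t) (ε dt² + g)` in product coordinates -/

section Product

variable {E : Type*} [NormedAddCommGroup E] [NormedSpace ℝ E]

/-- The form `φ(t) (ε dt² + G)` on `ℝ × E`, where `G` is a form on `E`. -/
noncomputable def productForm (ε : ℝ) (φ : ℝ → ℝ) (G : E → E →L[ℝ] E →L[ℝ] ℝ) (y : ℝ × E) :
    ℝ × E →L[ℝ] ℝ × E →L[ℝ] ℝ :=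
  φ y.1 • (ε • pullback (ContinuousLinearMap.mul ℝ ℝ) (ContinuousLinearMap.fst ℝ ℝ E) +
    pullback (G y.2) (ContinuousLinearMap.snd ℝ ℝ E))

theorem productForm_apply (ε : ℝ) (φ : ℝ → ℝ) (G : E → E →L[ℝ] E →L[ℝ] ℝ) (y u v : ℝ × E) :
    productForm ε φ G y u v = φ y.1 * (ε * (u.1 * v.1) + G y.2 u.2 v.2) := rfl

variable {ε : ℝ} {φ : ℝ → ℝ} {G : E → E →L[ℝ] E →L[ℝ] ℝ} {y : ℝ × E}

theorem contDiffAt_productForm (hφ : ContDiffAt ℝ 2 φ y.1) (hG : ContDiffAt ℝ 2 G y.2) :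
    ContDiffAt ℝ 2 (productForm ε φ G) y := by
  refine (hφ.comp y contDiffAt_fst).smul (contDiffAt_const.add ?_)
  exact contDiffAt_const.clm_comp ((hG.comp y contDiffAt_snd).clm_comp contDiffAt_const)

theorem fderiv_productForm (hφ : ContDiffAt ℝ 2 φ y.1) (hG : ContDiffAt ℝ 2 G y.2)
    (w u v : ℝ × E) :
    fderiv ℝ (productForm ε φ G) y w u v =
      deriv φ y.1 * w.1 * (ε * (u.1 * v.1) + G y.2 u.2 v.2) +
        φ y.1 * fderiv ℝ G y.2 w.2 u.2 v.2 := by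
  have hd := (contDiffAt_productForm (ε := ε) hφ hG).differentiableAt (by norm_num)
  have h1 : fderiv ℝ (productForm ε φ G) y w u v =
      fderiv ℝ (fun z => productForm ε φ G z u v) y w := by
    rw [((hd.hasFDerivAt.clm_apply (hasFDerivAt_const u y)).clm_apply
      (hasFDerivAt_const v y)).fderiv]
    simp
  have e1 : HasFDerivAt (fun z : ℝ × E => φ z.1)
      (deriv φ y.1 • ContinuousLinearMap.fst ℝ ℝ E) y :=
    ((hφ.differentiableAt (by norm_num)).hasDerivAt).comp_hasFDerivAt y hasFDerivAt_fst
  have e2 : HasFDerivAt (fun z : ℝ × E => G z.2)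
      (fderiv ℝ G y.2 ∘L ContinuousLinearMap.snd ℝ ℝ E) y :=
    ((hG.differentiableAt (by norm_num)).hasFDerivAt).comp y hasFDerivAt_snd
  have e3 := e1.mul (((e2.clm_apply (hasFDerivAt_const u.2 y)).clm_apply
    (hasFDerivAt_const v.2 y)).const_add (ε * (u.1 * v.1)))
  rw [h1]
  have e4 := congrArg (· w) e3.fderiv
  refine e4.trans ?_
  simp
  ring

variable [FiniteDimensional ℝ E]

theorem isInvertible_productForm (hε : ε ≠ 0) (hφ : φ y.1 ≠ 0) (hG : (G y.2).IsInvertible) :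
    (productForm ε φ G y).IsInvertible := by
  refine isInvertible_of_nondegenerate fun u hu => ?_
  have key : ∀ v : ℝ × E, ε * (u.1 * v.1) + G y.2 u.2 v.2 = 0 := fun v =>
    (mul_eq_zero.1 (hu v)).resolve_left hφ
  have h1 : u.1 = 0 := by simpa [hε] using key (1, 0)
  have h2 : G y.2 u.2 = 0 := by
    ext v
    simpa using key (0, v)
  exact Prod.ext h1 (hG.injective (h2.trans (map_zero _).symm))

/-- The Christoffel symbols of `φ(t) (ε dt² + G)`. -/
theorem christoffel_productForm (hε : ε * ε = 1) (hφ0 : φ y.1 ≠ 0) (hi : (G y.2).IsInvertible)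
    (hφ : ContDiffAt ℝ 2 φ y.1) (hG : ContDiffAt ℝ 2 G y.2)
    {a : ℝ} (ha : 2 * φ y.1 * a = deriv φ y.1) (u v : ℝ × E) :
    christoffel (productForm ε φ G) y u v =
      (a * (u.1 * v.1 - ε * G y.2 u.2 v.2),
        (a * u.1) • v.2 + (a * v.1) • u.2 + christoffel G y.2 u.2 v.2) := by
  rw [christoffel_eq_iff (isInvertible_productForm (left_ne_zero_of_mul_eq_one hε) hφ0 hi)]
  intro w
  rw [productForm_apply, christoffelFirst_apply, fderiv_productForm hφ hG,
    fderiv_productForm hφ hG, fderiv_productForm hφ hG, ← ha]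
  have h := apply_christoffel hi u.2 v.2 w.2
  rw [christoffelFirst_apply] at h
  simp only [map_add, map_smul, add_apply, smul_apply, smul_eq_mul, h]
  linear_combination (-φ y.1 * a * w.1 * G y.2 u.2 v.2) * hε

/-- The Ricci tensor of `φ(t) (ε dt² + G)` in terms of that of `G` and of `a = φ' / (2 φ)`. -/
theorem ricci_productForm (hε : ε * ε = 1) {a : ℝ → ℝ} {a' : ℝ}
    (hφ0 : ∀ᶠ t in nhds y.1, φ t ≠ 0) (hi : ∀ᶠ x in nhds y.2, (G x).IsInvertible)
    (hφ : ∀ᶠ t in nhds y.1, ContDiffAt ℝ 2 φ t) (hG : ∀ᶠ x in nhds y.2, ContDiffAt ℝ 2 G x)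
    (hs : ∀ᶠ x in nhds y.2, ∀ u v, G x u v = G x v u)
    (ha : ∀ᶠ t in nhds y.1, 2 * φ t * a t = deriv φ t) (ha' : HasDerivAt a a' y.1) (u v : ℝ × E) :
    ricci (productForm ε φ G) y u v = ricci G y.2 u.2 v.2
      - Module.finrank ℝ E * (a' * (u.1 * v.1))
      - ε * (a' + (Module.finrank ℝ E - 1) * a y.1 ^ 2) * G y.2 u.2 v.2 := by
  set Γ := christoffel G with hΓ
  set Γ' := christoffel (productForm ε φ G) with hΓ'
  have fstT : Filter.Tendsto (Prod.fst : ℝ × E → ℝ) (nhds y) (nhds y.1) := continuous_fst.tendsto y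
  have sndT : Filter.Tendsto (Prod.snd : ℝ × E → E) (nhds y) (nhds y.2) := continuous_snd.tendsto y
  have formula : ∀ᶠ z in nhds y, ∀ u v : ℝ × E, Γ' z u v =
      (a z.1 * (u.1 * v.1 - ε * G z.2 u.2 v.2),
        (a z.1 * u.1) • v.2 + (a z.1 * v.1) • u.2 + Γ z.2 u.2 v.2) := by
    filter_upwards [fstT hφ0, fstT hφ, fstT ha, sndT hi, sndT hG] with z z1 z2 z3 z4 z5 u v
    exact christoffel_productForm hε z1 z4 z2 z5 z3 u v
  have Γd : DifferentiableAt ℝ Γ y.2 := christoffel_differentiableAt hG.self_of_nhds hi.self_of_nhds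
  have Γ'd : DifferentiableAt ℝ Γ' y :=
    christoffel_differentiableAt (contDiffAt_productForm hφ.self_of_nhds hG.self_of_nhds)
      (isInvertible_productForm (left_ne_zero_of_mul_eq_one hε) hφ0.self_of_nhds hi.self_of_nhds)
  have Gd : DifferentiableAt ℝ G y.2 := hG.self_of_nhds.differentiableAt (by norm_num)
  have Γs : ∀ u v, Γ y.2 u v = Γ y.2 v u := christoffel_symm Gd hs
  have Gs := hs.self_of_nhds
  have DΓ' : ∀ w u v : ℝ × E, fderiv ℝ Γ' y w u v =
      (a' * w.1 * (u.1 * v.1 - ε * G y.2 u.2 v.2) - a y.1 * (ε * fderiv ℝ G y.2 w.2 u.2 v.2),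
        (a' * w.1 * u.1) • v.2 + (a' * w.1 * v.1) • u.2 + fderiv ℝ Γ y.2 w.2 u.2 v.2) := by
    intro w u v
    rw [fderiv_apply_apply Γ'd, Filter.EventuallyEq.fderiv_eq (formula.mono fun z hz => hz u v)]
    have e1 : HasFDerivAt (fun z : ℝ × E => a z.1) (a' • ContinuousLinearMap.fst ℝ ℝ E) y :=
      ha'.comp_hasFDerivAt y hasFDerivAt_fst
    have e2 : HasFDerivAt (fun z : ℝ × E => G z.2)
        (fderiv ℝ G y.2 ∘L ContinuousLinearMap.snd ℝ ℝ E) y :=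
      Gd.hasFDerivAt.comp y hasFDerivAt_snd
    have e3 : HasFDerivAt (fun z : ℝ × E => Γ z.2)
        (fderiv ℝ Γ y.2 ∘L ContinuousLinearMap.snd ℝ ℝ E) y :=
      Γd.hasFDerivAt.comp y hasFDerivAt_snd
    have f1 := e1.mul ((((e2.clm_apply (hasFDerivAt_const u.2 y)).clm_apply
      (hasFDerivAt_const v.2 y)).const_mul ε).const_sub (u.1 * v.1))
    have f2 := (((e1.mul_const u.1).smul_const v.2).add ((e1.mul_const v.1).smul_const u.2)).add
      ((e3.clm_apply (hasFDerivAt_const u.2 y)).clm_apply (hasFDerivAt_const v.2 y))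
    refine (congrArg (· w) (f1.prodMk f2).fderiv).trans (Prod.ext ?_ ?_)
    · simp
      ring
    · simp [mul_comm, mul_left_comm]
  have F := formula.self_of_nhds
  -- the `E`-component of `R(w, u) v` for `w` tangent to `E`
  have c2 : ∀ w : E, (curvature (productForm ε φ G) y (0, w) u v).2 =
      curvature G y.2 w u.2 v.2 - (a' * (u.1 * v.1) + a y.1 ^ 2 * ε * G y.2 u.2 v.2) • w
        + (a y.1 ^ 2 * ε * G y.2 v.2 w) • u.2 := by
    intro w
    simp only [curvature, ← hΓ, ← hΓ', DΓ', F, Prod.snd_add, Prod.snd_sub, map_add,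
      map_smul]
    rw [Gs v.2 w, Γs w u.2]
    module
  have c1 : (curvature (productForm ε φ G) y (1, 0) u v).1 = -(ε * a' * G y.2 u.2 v.2) := by
    simp only [curvature, ← hΓ', DΓ', F, Prod.fst_add, Prod.fst_sub, map_add, map_smul, map_zero,
      zero_apply, smul_eq_mul]
    simp
    ring
  let L₀ : E →ₗ[ℝ] E :=
    { toFun := fun w => curvature G y.2 w u.2 v.2
      map_add' := by
        intro a b
        simp only [curvature, map_add, add_apply]
        abel
      map_smul' := by
        intro c a
        simp only [curvature, map_smul, smul_apply, RingHom.id_apply, smul_sub, smul_add] }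
  have hL₀ : LinearMap.trace ℝ E L₀ = ricci G y.2 u.2 v.2 := rfl
  let L₂ : E →ₗ[ℝ] E := L₀ - (a' * (u.1 * v.1) + a y.1 ^ 2 * ε * G y.2 u.2 v.2) • LinearMap.id +
    (a y.1 ^ 2 * ε) • (G y.2 v.2 : E →ₗ[ℝ] ℝ).smulRight u.2
  unfold ricci
  rw [trace_real_prod _ L₂ (fun w => by
    simp only [LinearMap.coe_mk, AddHom.coe_mk, c2, L₂, L₀]
    simp [smul_smul])]
  simp only [L₂, map_add, map_sub, map_smul, LinearMap.trace_id, hL₀, LinearMap.trace_smulRight,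
    smul_eq_mul]
  simp only [LinearMap.coe_mk, AddHom.coe_mk, c1, ricci, ContinuousLinearMap.coe_coe]
  rw [Gs v.2 u.2]
  ring

end Product

/-! ### The Ricci tensor of the conformal product -/

section Manifold

variable {E : Type*} [NormedAddCommGroup E] [NormedSpace ℝ E]
  {M : Type*} [TopologicalSpace M] [ChartedSpace E M]

theorem Metric.contDiffAt_inChart (g : Metric 𝓘(ℝ, E) M) {e : OpenPartialHomeomorph M E}
    (he : e ∈ atlas E M) {x : E} (hx : x ∈ e.target) : ContDiffAt ℝ 3 (inChart g.val e) x := by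
  have h : ContDiffOn ℝ 3 (inChart g.val e) e.target := by
    simpa [mfld_simps] using g.contDiffOn e he
  exact h.contDiffAt (e.open_target.mem_nhds hx)

theorem Metric.inChart_symm (g : Metric 𝓘(ℝ, E) M) (e : OpenPartialHomeomorph M E) (x u v : E) :
    inChart g.val e x u v = inChart g.val e x v u :=
  g.symm _ _ _

/-- In the model space `E`, the extended charts of the definition are the charts. -/
theorem Metric.isEinsteinWith_iff (g : Metric 𝓘(ℝ, E) M) (k : ℝ) :
    g.IsEinsteinWith k ↔ ∀ e ∈ atlas E M, ∀ x ∈ e.target, ∀ u v : E,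
      ricci (inChart g.val e) x u v =
        ((Module.finrank ℝ E : ℝ) - 1) * k * inChart g.val e x u v := by
  simp only [Metric.IsEinsteinWith, Metric.RicciEq]
  simp [mfld_simps]

variable [IsManifold 𝓘(ℝ, E) 4 M]

theorem Metric.inChart_nondegenerate [CompleteSpace E] (g : Metric 𝓘(ℝ, E) M)
    {e : OpenPartialHomeomorph M E} (he : e ∈ atlas E M) {x : E} (hx : x ∈ e.target) (u : E)
    (hu : ∀ v, inChart g.val e x u v = 0) : u = 0 := by
  have : IsManifold 𝓘(ℝ, E) 1 M := IsManifold.of_le (n := 4) (by norm_num)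
  have hm := (mdifferentiable_of_mem_atlas (I := 𝓘(ℝ, E)) he).symm
  have hb := hm.mfderiv_bijective (x := x) hx
  refine hb.1 (Eq.trans ?_ (map_zero _).symm)
  refine g.nondegenerate _ _ fun v => ?_
  obtain ⟨w, rfl⟩ := hb.2 v
  exact hu w

variable [FiniteDimensional ℝ E]

theorem Metric.isInvertible_inChart (g : Metric 𝓘(ℝ, E) M) {e : OpenPartialHomeomorph M E}
    (he : e ∈ atlas E M) {x : E} (hx : x ∈ e.target) : (inChart g.val e x).IsInvertible :=
  have := FiniteDimensional.complete ℝ E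
  isInvertible_of_nondegenerate (g.inChart_nondegenerate he hx)

theorem Metric.exists_inChart_ne_zero [Nontrivial E] (g : Metric 𝓘(ℝ, E) M)
    {e : OpenPartialHomeomorph M E} (he : e ∈ atlas E M) {x : E} (hx : x ∈ e.target) :
    ∃ u v, inChart g.val e x u v ≠ 0 := by
  have := FiniteDimensional.complete ℝ E
  obtain ⟨u, hu⟩ := exists_ne (0 : E)
  by_contra! h
  exact hu (g.inChart_nondegenerate he hx u (h u))

/-- The Ricci tensor of `f(t)⁻² (ε dt² + g)` in a product chart. -/
theorem ricci_conformalProductForm {J : TopologicalSpace.Opens ℝ} {ε : ℝ} (hε : ε * ε = 1)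
    {f : ℝ → ℝ} (hf : ContDiffOn ℝ 4 f J) (hf0 : ∀ t ∈ J, f t ≠ 0) (g : Metric 𝓘(ℝ, E) M)
    {e₁ : OpenPartialHomeomorph J ℝ} (h₁ : e₁ ∈ atlas ℝ J)
    {e₂ : OpenPartialHomeomorph M E} (h₂ : e₂ ∈ atlas E M)
    {y : ℝ × E} (hy₁ : y.1 ∈ e₁.target) (hy₂ : y.2 ∈ e₂.target) (u v : ℝ × E) :
    ricci (inChart (conformalProductForm J ε f g.val) (e₁.prod e₂)) y u v =
      ricci (inChart g.val e₂) y.2 u.2 v.2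
        + (f y.1 ^ 2)⁻¹ * (Module.finrank ℝ E *
            (f y.1 * deriv (deriv f) y.1 - deriv f y.1 ^ 2) * (u.1 * v.1)
          + ε * (f y.1 * deriv (deriv f) y.1 - Module.finrank ℝ E * deriv f y.1 ^ 2) *
            inChart g.val e₂ y.2 u.2 v.2) := by
  have hJ : ∀ t ∈ e₁.target, t ∈ J := fun t ht => by
    rw [← mem_atlas_opens h₁ t ht]; exact (e₁.symm t).2
  have hf2 : ContDiffOn ℝ 2 f J := hf.of_le (by norm_num)
  have near₁ : ∀ᶠ t in nhds y.1, t ∈ J := J.isOpen.mem_nhds (hJ _ hy₁)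
  have near₂ : ∀ᶠ x in nhds y.2, x ∈ e₂.target := e₂.open_target.mem_nhds hy₂
  have hy : f y.1 ≠ 0 := hf0 _ (hJ _ hy₁)
  have germ : inChart (conformalProductForm J ε f g.val) (e₁.prod e₂) =ᶠ[nhds y]
      productForm ε (fun t => (f t ^ 2)⁻¹) (inChart g.val e₂) := by
    filter_upwards [(e₁.open_target.prod e₂.open_target).mem_nhds
      (show y ∈ e₁.target ×ˢ e₂.target from ⟨hy₁, hy₂⟩)] with z hz
    refine ContinuousLinearMap.ext fun u => ContinuousLinearMap.ext fun v => ?_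
    exact inChart_conformalProductForm h₁ h₂ hz.1 hz.2 u v
  have hd : ∀ t ∈ J, HasDerivAt f (deriv f t) t := fun t ht =>
    hasDerivAt_of_contDiffOn_two J.isOpen hf2 ht
  -- here `φ = f⁻²`, so that `φ' / (2 φ) = -f' / f`
  have hφ' : ∀ t ∈ J, 2 * (f t ^ 2)⁻¹ * -(deriv f t / f t) = deriv (fun t => (f t ^ 2)⁻¹) t := by
    intro t ht
    have h0 := hf0 t ht
    have h := (((hd t ht).pow 2).inv (pow_ne_zero 2 h0)).deriv
    refine Eq.trans ?_ h.symm
    simp only [Pi.pow_apply, Nat.cast_ofNat]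
    field_simp
    ring
  have ha' := (((hasDerivAt_deriv_of_contDiffOn_two J.isOpen hf2 (hJ _ hy₁)).div
    (hd _ (hJ _ hy₁)) hy).neg)
  rw [ricci_congr germ, ricci_productForm hε (a := fun t => -(deriv f t / f t))
    (near₁.mono fun t ht => inv_ne_zero (pow_ne_zero 2 (hf0 t ht)))
    (near₂.mono fun x hx => g.isInvertible_inChart h₂ hx)
    (near₁.mono fun t ht => ((hf2.contDiffAt (J.isOpen.mem_nhds ht)).pow 2).inv
      (pow_ne_zero 2 (hf0 t ht)))
    (near₂.mono fun x hx => (g.contDiffAt_inChart h₂ hx).of_le (by norm_num))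
    (Filter.Eventually.of_forall fun x => g.inChart_symm e₂ x)
    (near₁.mono hφ') ha']
  field_simp
  ring

/-- Splitting `Ric = lam • (f⁻² (ε dt² + g))` into its `dt²`-part and its part along `M`; the mixed
components vanish on both sides. -/
theorem ricciEq_conformalProduct_iff (J : TopologicalSpace.Opens ℝ) (ε : ℝ) (hε : ε = 1 ∨ ε = -1)
    (f : ℝ → ℝ) (hf : ContDiffOn ℝ 4 f J) (hf0 : ∀ t ∈ J, f t ≠ 0) (g : Metric 𝓘(ℝ, E) M)
    (lam : J × M → ℝ) :
    (conformalProduct J ε hε f hf hf0 g).RicciEq lam ↔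
      ∀ (t : ℝ) (ht : t ∈ J), ∀ e ∈ atlas E M, ∀ x ∈ e.target,
        (Module.finrank ℝ E : ℝ) * (f t * deriv (deriv f) t - deriv f t ^ 2) =
            ε * lam (⟨t, ht⟩, e.symm x) ∧
          ∀ u v : E, ricci (inChart g.val e) x u v * f t ^ 2 =
            (lam (⟨t, ht⟩, e.symm x) -
              ε * (f t * deriv (deriv f) t - Module.finrank ℝ E * deriv f t ^ 2)) *
              inChart g.val e x u v := by
  have hε2 : ε * ε = 1 := by rcases hε with rfl | rfl <;> norm_num
  have htar : ∀ (e₁ : OpenPartialHomeomorph J ℝ) (e₂ : OpenPartialHomeomorph M E),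
      ((e₁.prod e₂).extend (𝓘(ℝ, ℝ).prod 𝓘(ℝ, E))).target = e₁.target ×ˢ e₂.target := by
    intro e₁ e₂
    rw [OpenPartialHomeomorph.extend_prod]
    simp [mfld_simps]
  constructor
  · intro H t ht e₂ h₂ x hx
    have hft := hf0 t ht
    let e₁ : OpenPartialHomeomorph J ℝ := chartAt ℝ (⟨t, ht⟩ : J)
    have h₁ : e₁ ∈ atlas ℝ J := chart_mem_atlas ℝ _
    have hsrc : (⟨t, ht⟩ : J) ∈ e₁.source := mem_chart_source ℝ _
    have hval : e₁ ⟨t, ht⟩ = t := by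
      have h := mem_atlas_opens h₁ _ (e₁.map_source hsrc)
      rw [e₁.left_inv hsrc] at h
      exact h.symm
    have ht₁ : t ∈ e₁.target := hval ▸ e₁.map_source hsrc
    have hsymm : e₁.symm t = ⟨t, ht⟩ := Subtype.ext (mem_atlas_opens h₁ t ht₁)
    have key : ∀ u v : ℝ × E, ricci (inChart (conformalProductForm J ε f g.val) (e₁.prod e₂))
        (t, x) u v = lam (⟨t, ht⟩, e₂.symm x) *
          inChart (conformalProductForm J ε f g.val) (e₁.prod e₂) (t, x) u v := by
      intro u v
      have h := H (e₁.prod e₂) ⟨e₁, h₁, e₂, h₂, rfl⟩ (t, x) (by rw [htar]; exact ⟨ht₁, hx⟩) u v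
      rw [← hsymm]
      exact h
    have key' := fun u v => (ricci_conformalProductForm hε2 hf hf0 g h₁ h₂ (y := (t, x)) ht₁ hx
      u v).symm.trans ((key u v).trans (congrArg _
        (inChart_conformalProductForm h₁ h₂ (y := (t, x)) ht₁ hx u v)))
    constructor
    · have h := key' (1, 0) (1, 0)
      have hz : ricci (inChart g.val e₂) x 0 0 = 0 := by
        rw [ricci_eq_trace _ _ _ _ 0 (fun w => by simp [curvature]), map_zero]
      simp only [hz, map_zero, mul_zero, mul_one, add_zero, zero_add] at h
      field_simp at h
      linear_combination h
    · intro u v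
      have h := key' (0, u) (0, v)
      simp only [mul_zero, zero_add] at h
      field_simp at h
      linear_combination h
  · rintro H _ ⟨e₁, h₁, e₂, h₂, rfl⟩ y hy u v
    rw [htar] at hy
    have htJ : y.1 ∈ J := by
      rw [← mem_atlas_opens h₁ y.1 hy.1]; exact (e₁.symm y.1).2
    have hsymm : e₁.symm y.1 = ⟨y.1, htJ⟩ := Subtype.ext (mem_atlas_opens h₁ y.1 hy.1)
    obtain ⟨hT, hM⟩ := H y.1 htJ e₂ h₂ y.2 hy.2
    have hl : lam (((e₁.prod e₂).extend (𝓘(ℝ, ℝ).prod 𝓘(ℝ, E))).symm y) =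
        lam (⟨y.1, htJ⟩, e₂.symm y.2) := by
      rw [← hsymm]; rfl
    have hft := hf0 _ htJ
    refine (ricci_conformalProductForm hε2 hf hf0 g h₁ h₂ hy.1 hy.2 u v).trans ?_
    refine Eq.trans ?_ (congrArg₂ (· * ·) hl.symm
      (inChart_conformalProductForm h₁ h₂ hy.1 hy.2 u v).symm)
    have hM' := hM u.2 v.2
    field_simp
    linear_combination hM' + (u.1 * v.1) * hT

end Manifold

/-! ### Einstein conformal products -/

section Einstein

variable {E : Type*} [NormedAddCommGroup E] [NormedSpace ℝ E] [FiniteDimensional ℝ E]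
  {M : Type*} [TopologicalSpace M] [ChartedSpace E M] [IsManifold 𝓘(ℝ, E) 4 M]
  {J : TopologicalSpace.Opens ℝ} {ε : ℝ} {f : ℝ → ℝ}

/-- The `dt²`-part of the Einstein equation determines `lam` as a function of `t`; comparing the
part along `M` at two values of `t` then shows that `f'' / f` is constant, and that `g` is
Einstein. -/
theorem exists_of_isEinstein_conformalProduct [Nonempty M] (hn : 2 ≤ Module.finrank ℝ E)
    (hε : ε = 1 ∨ ε = -1) (hf : ContDiffOn ℝ 4 f J) (hf0 : ∀ t ∈ J, f t ≠ 0)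
    (hJ : (J : Set ℝ).Nonempty) (g : Metric 𝓘(ℝ, E) M)
    (H : (conformalProduct J ε hε f hf hf0 g).IsEinstein) :
    ∃ k : ℝ, g.IsEinsteinWith k ∧ ∀ t ∈ J, deriv (deriv f) t = ε * k * f t := by
  have hε2 : ε * ε = 1 := by rcases hε with rfl | rfl <;> norm_num
  have : Nontrivial E := Module.nontrivial_of_finrank_pos (R := ℝ) (by omega)
  have hn1 : (Module.finrank ℝ E : ℝ) - 1 ≠ 0 := by
    have : (2 : ℝ) ≤ Module.finrank ℝ E := by exact_mod_cast hn
    linarith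
  obtain ⟨lam, hlam, -⟩ := H
  rw [ricciEq_conformalProduct_iff] at hlam
  have key : ∀ t ∈ J, ∀ e ∈ atlas E M, ∀ x ∈ e.target, ∀ u v : E,
      ricci (inChart g.val e) x u v =
        ((Module.finrank ℝ E : ℝ) - 1) * (ε * deriv (deriv f) t / f t) *
          inChart g.val e x u v := by
    intro t ht e he x hx u v
    obtain ⟨hT, hM⟩ := hlam t ht e he x hx
    have hft := hf0 t ht
    field_simp
    refine mul_right_cancel₀ hft ?_
    linear_combination hM u v - ε * inChart g.val e x u v * hT
      - lam (⟨t, ht⟩, e.symm x) * inChart g.val e x u v * hε2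
  obtain ⟨t₀, ht₀⟩ := hJ
  refine ⟨ε * deriv (deriv f) t₀ / f t₀, (g.isEinsteinWith_iff _).2 (key t₀ ht₀),
    fun t ht => ?_⟩
  let x : M := Classical.arbitrary M
  have he := chart_mem_atlas E x
  have hx := mem_chart_target E x
  obtain ⟨u, v, huv⟩ := g.exists_inChart_ne_zero he hx
  have h1 := (key t ht _ he _ hx u v).symm.trans (key t₀ ht₀ _ he _ hx u v)
  have h2 := mul_left_cancel₀ hn1 (mul_right_cancel₀ huv h1)
  have hft := hf0 t ht
  rw [div_eq_iff hft] at h2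
  linear_combination ε * h2 - deriv (deriv f) t * hε2

/-- If `g` is Einstein, then the Einstein equation for `f⁻² (ε dt² + g)` amounts to two ordinary
differential equations, which by `first_order_iff_second_order` are equivalent to the first order
equation. -/
theorem isEinsteinWith_conformalProduct_iff [Nonempty M] (hn : 2 ≤ Module.finrank ℝ E)
    (hJ : (J : Set ℝ).OrdConnected) (hε : ε = 1 ∨ ε = -1) (hf : ContDiffOn ℝ 4 f J)
    (hf0 : ∀ t ∈ J, f t ≠ 0) (hfc : ∃ s ∈ J, ∃ t ∈ J, f s ≠ f t) (g : Metric 𝓘(ℝ, E) M)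
    {k : ℝ} (kbar : ℝ) (hg : g.IsEinsteinWith k) :
    (conformalProduct J ε hε f hf hf0 g).IsEinsteinWith kbar ↔
      ∀ t ∈ J, k * f t ^ 2 - ε * deriv f t ^ 2 = kbar := by
  have hε2 : ε * ε = 1 := by rcases hε with rfl | rfl <;> norm_num
  have : Nontrivial E := Module.nontrivial_of_finrank_pos (R := ℝ) (by omega)
  have hn2 : (2 : ℝ) ≤ Module.finrank ℝ E := by exact_mod_cast hn
  have hn1 : (Module.finrank ℝ E : ℝ) - 1 ≠ 0 := by linarith
  have hfin : ((Module.finrank ℝ (ℝ × E) : ℝ) - 1) = Module.finrank ℝ E := by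
    rw [Module.finrank_prod, Module.finrank_self]
    push_cast
    ring
  have hf2 : ContDiffOn ℝ 2 f J := hf.of_le (by norm_num)
  rw [g.isEinsteinWith_iff] at hg
  rw [Metric.IsEinsteinWith, ricciEq_conformalProduct_iff, hfin]
  constructor
  · intro H t ht
    let x : M := Classical.arbitrary M
    have he := chart_mem_atlas E x
    have hx := mem_chart_target E x
    obtain ⟨u, v, huv⟩ := g.exists_inChart_ne_zero he hx
    obtain ⟨hT, hM⟩ := H t ht _ he _ hx
    have hM' := hM u v
    rw [hg _ he _ hx] at hM'
    have hT' : f t * deriv (deriv f) t - deriv f t ^ 2 = ε * kbar :=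
      mul_left_cancel₀ (a := (Module.finrank ℝ E : ℝ)) (by linarith) (by linarith)
    refine mul_left_cancel₀ hn1 (mul_right_cancel₀ huv ?_)
    linear_combination hM' - ε * inChart g.val (chartAt E x) (chartAt E x x) u v * hT'
      - kbar * inChart g.val (chartAt E x) (chartAt E x x) u v * hε2
  · intro H t ht e he x hx
    have h2 := (first_order_iff_second_order J.isOpen hJ hε hf2 hf0 hfc k).1 ⟨kbar, H⟩ t ht
    have h1 := H t ht
    constructor
    · rw [h2]
      linear_combination (Module.finrank ℝ E * ε) * h1 + Module.finrank ℝ E * deriv f t ^ 2 * hε2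
    · intro u v
      rw [hg e he x hx, h2]
      linear_combination (Module.finrank ℝ E * inChart g.val e x u v) * h1 +
        k * inChart g.val e x u v * f t ^ 2 * hε2

end Einstein

end PseudoRiemannian

theorem mainTheorem5
    {E : Type*} [NormedAddCommGroup E] [NormedSpace ℝ E] [FiniteDimensional ℝ E]
    (hn : 2 ≤ Module.finrank ℝ E)
    {M : Type*} [TopologicalSpace M] [ChartedSpace E M] [IsManifold 𝓘(ℝ, E) 4 M]
    [ConnectedSpace M] (g : PseudoRiemannian.Metric 𝓘(ℝ, E) M)
    (J : TopologicalSpace.Opens ℝ) (hJ : (J : Set ℝ).OrdConnected)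
    (ε : ℝ) (hε : ε = 1 ∨ ε = -1)
    (f : ℝ → ℝ) (hf : ContDiffOn ℝ 4 f J) (hf0 : ∀ t ∈ J, f t ≠ 0)
    (hfc : ∃ s ∈ J, ∃ t ∈ J, f s ≠ f t) :
    -- `f⁻² (ε dt² + g)` is Einstein iff `g` is Einstein and `f` satisfies the first order equation
    ((PseudoRiemannian.conformalProduct J ε hε f hf hf0 g).IsEinstein ↔
      ∃ k kbar : ℝ, g.IsEinsteinWith k ∧
        ∀ t ∈ J, k * f t ^ 2 - ε * deriv f t ^ 2 = kbar) ∧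
    -- the constant `kbar` is the normalized Einstein constant of `f⁻² (ε dt² + g)`
    (∀ k kbar : ℝ, g.IsEinsteinWith k →
      ((PseudoRiemannian.conformalProduct J ε hε f hf hf0 g).IsEinsteinWith kbar ↔
        ∀ t ∈ J, k * f t ^ 2 - ε * deriv f t ^ 2 = kbar)) ∧
    -- equivalence with the second order equation
    (∀ k : ℝ, (∃ kbar : ℝ, ∀ t ∈ J, k * f t ^ 2 - ε * deriv f t ^ 2 = kbar) ↔
      ∀ t ∈ J, deriv (deriv f) t = ε * k * f t) ∧
    -- explicit solutions in the Riemannian case, on any open interval containing `0`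
    (∀ (U : Set ℝ) (h : ℝ → ℝ), IsOpen U → U.OrdConnected → (0 : ℝ) ∈ U → ContDiffOn ℝ 2 h U →
      (∀ k : ℝ, PseudoRiemannian.SolvesIVP U h k 1 1 0 ↔
        k = 1 ∧ ∀ t ∈ U, h t = Real.cosh t) ∧
      (∀ k : ℝ, PseudoRiemannian.SolvesIVP U h k (-1) 1 0 ↔
        k = -1 ∧ ∀ t ∈ U, h t = Real.cos t) ∧
      (∀ k : ℝ, PseudoRiemannian.SolvesIVP U h k 0 1 0 ↔
        k = 0 ∧ ∀ t ∈ U, h t = 1) ∧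
      (∀ k : ℝ, PseudoRiemannian.SolvesIVP U h k 0 1 1 ↔
        k = 1 ∧ ∀ t ∈ U, h t = Real.exp t) ∧
      (∀ k : ℝ, PseudoRiemannian.SolvesIVP U h k (-1) 1 1 ↔
        k = 0 ∧ ∀ t ∈ U, h t = t + 1) ∧
      (∀ k : ℝ, PseudoRiemannian.SolvesIVP U h k 1 1 1 ↔
        k = 2 ∧ ∀ t ∈ U, h t = 1 / (2 * √2) *
          ((√2 + 1) * Real.exp (√2 * t) + (√2 - 1) * Real.exp (-√2 * t))) ∧
      (∀ kbar : ℝ, PseudoRiemannian.SolvesIVP U h 1 kbar 0 1 ↔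
        kbar = -1 ∧ ∀ t ∈ U, h t = Real.sinh t) ∧
      (∀ kbar : ℝ, PseudoRiemannian.SolvesIVP U h (-1) kbar 0 1 ↔
        kbar = -1 ∧ ∀ t ∈ U, h t = Real.sin t) ∧
      (∀ kbar : ℝ, PseudoRiemannian.SolvesIVP U h 0 kbar 0 1 ↔
        kbar = -1 ∧ ∀ t ∈ U, h t = t) ∧
      (∀ k kbar : ℝ, PseudoRiemannian.SolvesIVP U h k kbar 0 0 ↔
        kbar = 0 ∧ ∀ t ∈ U, h t = 0)) := by
  have hJne : (J : Set ℝ).Nonempty := hfc.imp fun _ h => h.1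
  have hf2 : ContDiffOn ℝ 2 f J := hf.of_le (by norm_num)
  have ode := PseudoRiemannian.first_order_iff_second_order J.isOpen hJ hε hf2 hf0 hfc
  have einstein := fun k kbar hg => PseudoRiemannian.isEinsteinWith_conformalProduct_iff
    hn hJ hε hf hf0 hfc g (k := k) kbar hg
  refine ⟨⟨fun H => ?_, ?_⟩, einstein, ode, PseudoRiemannian.solvesIVP_explicit⟩
  · obtain ⟨k, hk, h2⟩ :=
      PseudoRiemannian.exists_of_isEinstein_conformalProduct hn hε hf hf0 hJne g H
    obtain ⟨kbar, h1⟩ := (ode k).2 h2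
    exact ⟨k, kbar, hk, h1⟩
  · rintro ⟨k, kbar, hk, h1⟩
    exact ((einstein k kbar hk).2 h1).isEinstein
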